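/- Let $\Phi$ be a reduced irreducible (crystallographic) root system of rank $\geq 2$ whose Dynkin diagram is simply laced, and let $N_{\alpha,\beta}\in\{\pm1\}$ ($\alpha,\beta,\alpha+\beta\in\Phi$) be the structure constants of the Lie algebra of type $\Phi$ with respect to a Chevalley basis $(e_\alpha)$, i.e. $[e_\alpha,e_\beta]=N_{\alpha,\beta}\,e_{\alpha+\beta}$. For a commutative ring $R$ the Steinberg group $\mathrm{St}(\Phi,R)$ is the group with generators $x_\alpha(a)$, $\alpha\in\Phi$, $a\in R$, and relations $x_\alpha(a)x_\alpha(b)=x_\alpha(a+b)$; $[x_\alpha(a),x_\beta(b)]=x_{\alpha+\beta}(N_{\alpha,\beta}\,ab)$ if $\alpha+\beta\in\Phi$; $[x_\alpha(a),x_\beta(b)]=1$ if $\alpha+\beta\notin\Phi\cup\{0\}$, where $[x,y]=xyx^{-1}y^{-1}$. For an ideal $I$ of $R$ let $\overline{\mathrm{St}}(\Phi,R,I)$ be the kernel of $\mathrm{St}(\Phi,R)\to\mathrm{St}(\Phi,R/I)$. Let $A$ be a (commutative) local ring with maximal ideal $M$, and let $K(A[X],M[X])$ be the kernel of the homomorphism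 $\overline{\mathrm{St}}(\Phi,A[X],M[X])\to\overline{\mathrm{St}}(\Phi,A,M)$ induced by the evaluation $X\mapsto 0$. Then: 1. $K(A[X],M[X])$ is generated as a group by the subgroup $\overline{\mathrm{St}}(\Phi,A[X],XM[X])$ and the elements $[x_\alpha(m),x_{-\alpha}(X\xi)]$, where $m\in M$, $\xi\in A[X]$, $\alpha\in\Phi$. 2. For any fixed root $\gamma\in\Phi$, $K(A[X],M[X])$ is generated as a group by the subgroup $\overline{\mathrm{St}}(\Phi,A[X],XM[X])$ and the elements $[x_\gamma(m),x_{-\gamma}(X\eta)]$, where $m\in M$, $\eta\in A[X]$. -/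

import Mathlib

open Polynomial IsLocalRing
open scoped commutatorElement

noncomputable section

section ChevalleyBasis

variable {ι K V W : Type*} [Field K] [AddCommGroup V] [Module K V] [AddCommGroup W] [Module K W]

/-- A Chevalley basis of a Lie algebra `L` of type `P`: the split Cartan subalgebra is the
coroot space `W` (embedded by `h`), each root space is spanned by one vector `e i`,
`[e_α, e_{-α}]` is the coroot of `α`, and `[e_α, e_β] = N_{α,β} e_{α+β}` for integers `N_{α,β}`
with `N_{-α,-β} = -N_{α,β}` whenever `α + β` is a root.
Values `N i j` for which the sum of the two roots is not a root are irrelevant. -/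
structure ChevalleyBasis (P : RootPairing ι K V W) (L : Type*) [LieRing L] [LieAlgebra K L] where
  /-- the embedding of the Cartan subalgebra -/
  h : W →ₗ[K] L
  /-- the root vectors -/
  e : ι → L
  /-- the structure constants -/
  N : ι → ι → ℤ
  /-- `L` is the direct sum of the Cartan subalgebra and the lines spanned by the root vectors -/
  bijective : Function.Bijective
    fun p : W × (ι →₀ K) => h p.1 + Finsupp.linearCombination K e p.2
  lie_h_h : ∀ w w' : W, ⁅h w, h w'⁆ = 0
  lie_h_e : ∀ (w : W) (i : ι), ⁅h w, e i⁆ = P.root' i w • e i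
  lie_e_neg : ∀ i j : ι, P.root j = -P.root i → ⁅e i, e j⁆ = h (P.coroot i)
  lie_e_e : ∀ i j k : ι, P.root i + P.root j = P.root k → ⁅e i, e j⁆ = N i j • e k
  lie_e_e_eq_zero : ∀ i j : ι, P.root i + P.root j ≠ 0 →
    P.root i + P.root j ∉ Set.range P.root → ⁅e i, e j⁆ = 0
  N_neg : ∀ i j i' j' : ι, P.root i + P.root j ∈ Set.range P.root →
    P.root i' = -P.root i → P.root j' = -P.root j → N i' j' = -N i j

end ChevalleyBasis

section Steinberg

variable {ι K V W : Type*} [Field K] [AddCommGroup V] [Module K V] [AddCommGroup W] [Module K W]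

/-- The Steinberg relators for a simply laced root system with structure constants `N`,
over a commutative ring `R`; the letter `(i, a)` stands for `x_i(a)`. -/
inductive SteinbergRel (P : RootPairing ι K V W) (N : ι → ι → ℤ) (R : Type*) [CommRing R] :
    FreeGroup (ι × R) → Prop
  | add (i : ι) (a b : R) : SteinbergRel P N R
      (FreeGroup.of (i, a) * FreeGroup.of (i, b) * (FreeGroup.of (i, a + b))⁻¹)
  | comm (i j k : ι) (a b : R) (hk : P.root i + P.root j = P.root k) : SteinbergRel P N R
      (⁅FreeGroup.of (i, a), FreeGroup.of (j, b)⁆ * (FreeGroup.of (k, (N i j : R) * (a * b)))⁻¹)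
  | comm_one (i j : ι) (a b : R) (h0 : P.root i + P.root j ≠ 0)
      (hij : P.root i + P.root j ∉ Set.range P.root) : SteinbergRel P N R
      ⁅FreeGroup.of (i, a), FreeGroup.of (j, b)⁆

/-- The Steinberg group `St(Φ, R)` of a simply laced root system `Φ`. -/
abbrev SteinbergGroup (P : RootPairing ι K V W) (N : ι → ι → ℤ) (R : Type*) [CommRing R] : Type _ :=
  PresentedGroup {w | SteinbergRel P N R w}

namespace SteinbergGroup

variable (P : RootPairing ι K V W) (N : ι → ι → ℤ) {R S : Type*} [CommRing R] [CommRing S]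

/-- The generator `x_i(a)`. -/
def x (i : ι) (a : R) : SteinbergGroup P N R := PresentedGroup.of (i, a)

/-- The homomorphism `St(Φ, R) → St(Φ, S)` induced by a ring homomorphism,
`x_i(a) ↦ x_i(f a)`. -/
def map (f : R →+* S) : SteinbergGroup P N R →* SteinbergGroup P N S :=
  PresentedGroup.map (FreeGroup.map fun p : ι × R => (p.1, f p.2)) <| by
    rintro _ (⟨i, a, b⟩ | ⟨i, j, k, a, b, hk⟩ | ⟨i, j, a, b, h0, hij⟩)
    · simpa using SteinbergRel.add (P := P) (N := N) i (f a) (f b)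
    · simpa [map_commutatorElement] using
        SteinbergRel.comm (P := P) (N := N) i j k (f a) (f b) hk
    · simpa [map_commutatorElement] using
        SteinbergRel.comm_one (P := P) (N := N) i j (f a) (f b) h0 hij

theorem map_x (f : R →+* S) (i : ι) (a : R) : map P N f (x P N i a) = x P N i (f a) := rfl

theorem map_map {T : Type*} [CommRing T] (g : S →+* T) (f : R →+* S) (w : SteinbergGroup P N R) :
    map P N g (map P N f w) = map P N (g.comp f) w := by
  have : (map P N g).comp (map P N f) = map P N (g.comp f) :=
    PresentedGroup.ext fun _ => rfl
  exact DFunLike.congr_fun this w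

/-- The relative group `St̄(Φ, R, I)`, the kernel of `St(Φ, R) → St(Φ, R/I)`. -/
def rel (I : Ideal R) : Subgroup (SteinbergGroup P N R) :=
  (map P N (Ideal.Quotient.mk I)).ker

theorem map_mem_rel {I : Ideal R} {J : Ideal S} (f : R →+* S) (hf : I ≤ J.comap f)
    {w : SteinbergGroup P N R} (hw : w ∈ rel P N I) : map P N f w ∈ rel P N J := by
  rw [rel, MonoidHom.mem_ker] at hw ⊢
  rw [map_map, ← Ideal.quotientMap_comp_mk hf, ← map_map, hw, map_one]

/-- The homomorphism `St̄(Φ, R, I) → St̄(Φ, S, J)` induced by a morphism of pairs. -/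
def relMap {I : Ideal R} {J : Ideal S} (f : R →+* S) (hf : I ≤ J.comap f) :
    rel P N I →* rel P N J :=
  ((map P N f).comp (rel P N I).subtype).codRestrict (rel P N J)
    fun w => map_mem_rel P N f hf w.2

/-- `c_i(s, t) = [x_i(s), x_{-i}(t)]`; the index of the root opposite to the `i`-th one is
`P.reflectionPerm i i`. -/
def c (i : ι) (s t : R) : SteinbergGroup P N R :=
  ⁅x P N i s, x P N (P.reflectionPerm i i) t⁆

theorem map_C_le_comap_eval (A : Type*) [CommRing A] (M : Ideal A) :
    M.map (C : A →+* A[X]) ≤ M.comap (evalRingHom (0 : A)) := by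
  rw [Ideal.map_le_iff_le_comap]
  intro m hm
  simpa using hm

/-- `K(A[X], M[X])`: the kernel of `St̄(Φ, A[X], M[X]) → St̄(Φ, A, M)` induced by evaluation
at `0`, regarded as a subgroup of `St(Φ, A[X])`. Here `M[X] = M.map C`. -/
def evalKer (A : Type*) [CommRing A] (M : Ideal A) : Subgroup (SteinbergGroup P N A[X]) :=
  (relMap P N (evalRingHom (0 : A)) (map_C_le_comap_eval A M)).ker.map
    (rel P N (M.map (C : A →+* A[X]))).subtype

end SteinbergGroup

end Steinberg

end

/-! Write `R` for `A[X]` modulo `X M[X]`. The kernel of `reduction` to `St(Φ, R)` is `rel (X M[X])`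
by definition, so it suffices to determine the image of `evalKer` there. In `R` the images of `M[X]`
and `(X)` annihilate each other, which makes every `c_i(m, X ξ)` central (`c_mem_center`). Let `E`
be the central subgroup that they generate.

Modulo `E`, the images of `rel M[X]` and of each `x_j(X g)` commute (`commute_map_rel_x`). This
rests on generating a relative group by the conjugates `z_i(s, a)` (`rel_eq_zClosure`). Let `B` be
the image of `rel M`, embedded through constant polynomials. Splitting `f` as `f(0)` plus a multiple
of `X` shows that every `x_i(f)` normalises `B`, so `B` contains the image of `rel M[X]`
(`exists_map_C_of_mem_rel`). Hence `w` in `evalKer` equals a constant `v` modulo `E`, and evaluation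
at `0` forces `v = 1`.

For a single root, `c_k(a, b)` is the inverse of `c_i(a, ±b)` when `a * b = 0` and `k - i` is a root
(`c_eq_inv_c`). The graph of such pairs is connected, so one root already yields all of `E`. -/

set_option linter.unusedSectionVars false

/-! ### Root systems whose roots all have the same length -/

namespace RootPairing

variable {ι K V W : Type*} [Finite ι] [Field K] [CharZero K] [AddCommGroup V] [Module K V]
  [AddCommGroup W] [Module K W] {P : RootPairing ι K V W} [P.IsCrystallographic] [P.IsReduced]

/-- If the Dynkin diagram of an irreducible root system is simply laced, then its Cartan integers
are symmetric. -/
theorem pairingIn_comm_of_isSimplyLaced [P.IsRootSystem] [P.IsIrreducible] (b : P.Base)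
    (hb : b.cartanMatrix.IsSimplyLaced) (i j : ι) : P.pairingIn ℤ i j = P.pairingIn ℤ j i := by
  have := Fintype.ofFinite ι
  let F := (P.posRootForm ℤ).toInvariantForm
  have length_reflection (i j : ι) :
      F.form (P.root (P.reflectionPerm j i)) (P.root (P.reflectionPerm j i)) =
        F.form (P.root i) (P.root i) := by
    simp only [root_reflectionPerm, F.apply_reflection_reflection]
  obtain ⟨i₀, hi₀⟩ : b.support.Nonempty := by
    have : Nonempty ι := ⟨i⟩
    exact b.support_nonempty
  -- Adjacent simple roots pair to `-1` in both orders, hence have equal length; connectedness of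
  -- the diagram spreads this to all simple roots.
  have length_simple (j : b.support) :
      F.form (P.root j) (P.root j) = F.form (P.root i₀) (P.root i₀) := by
    refine b.induction_on_cartanMatrix
      (p := fun j => F.form (P.root j) (P.root j) = F.form (P.root i₀) (P.root i₀))
      (i := ⟨i₀, hi₀⟩) rfl fun k l hk hlk => ?_
    rcases eq_or_ne l k with rfl | hne
    · exact hk
    have h₁ : P.pairingIn ℤ l k = -1 := (hb hne).resolve_left hlk
    have h₂ : P.pairingIn ℤ k l = -1 :=
      (hb hne.symm).resolve_left fun h => hlk (b.cartanMatrix_apply_eq_zero_iff_symm.mp h)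
    have := F.pairing_mul_eq_pairing_mul_swap k l
    rw [← P.algebraMap_pairingIn ℤ, ← P.algebraMap_pairingIn ℤ, h₁, h₂] at this
    rw [← hk]
    simpa using this.symm
  have length_eq (j : ι) : F.form (P.root j) (P.root j) = F.form (P.root i₀) (P.root i₀) :=
    b.induction_reflect j (p := fun j => F.form (P.root j) (P.root j) =
        F.form (P.root i₀) (P.root i₀))
      (fun i hi => (length_reflection i i).trans hi) (fun i hi => length_simple ⟨i, hi⟩)
      fun i j hi _ => (length_reflection i j).trans hi
  have := P.pairingIn_pairingIn_mem_set_of_length_eq ((length_eq i).trans (length_eq j).symm)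
  simp only [Set.mem_insert_iff, Set.mem_singleton_iff, Prod.mk.injEq] at this
  omega

variable (P) in
/-- All roots have the same length: the Cartan integers are symmetric. -/
class IsPairingSymm : Prop where
  comm : ∀ i j, P.pairingIn ℤ i j = P.pairingIn ℤ j i

variable [P.IsPairingSymm]

variable (P) in
theorem pairingIn_comm (i j : ι) : P.pairingIn ℤ i j = P.pairingIn ℤ j i :=
  IsPairingSymm.comm i j

variable (P) in
theorem pairingIn_mem_Icc (i j : ι) : -2 ≤ P.pairingIn ℤ i j ∧ P.pairingIn ℤ i j ≤ 2 := by
  have := P.pairingIn_pairingIn_mem_set_of_isCrystallographic i j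
  have := P.pairingIn_comm i j
  simp only [Set.mem_insert_iff, Set.mem_singleton_iff, Prod.mk.injEq] at *
  omega

theorem eq_of_pairingIn_eq_two {i j : ι} (h : P.pairingIn ℤ i j = 2) : i = j :=
  (P.pairingIn_two_two_iff ℤ i j).mp ⟨h, P.pairingIn_comm i j ▸ h⟩

theorem eq_reflectionPerm_of_pairingIn_eq_neg_two {i j : ι} (h : P.pairingIn ℤ i j = -2) :
    j = P.reflectionPerm i i := by
  refine (eq_of_pairingIn_eq_two (P := P) ?_).symm
  rw [pairingIn_reflectionPerm_self_left, h, neg_neg]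

theorem pairingIn_add_left {i j k : ι} (h : P.root i + P.root j = P.root k) (l : ι) :
    P.pairingIn ℤ k l = P.pairingIn ℤ i l + P.pairingIn ℤ j l :=
  pairingIn_eq_add_of_root_eq_add h.symm

theorem pairingIn_add_right {i j k : ι} (h : P.root i + P.root j = P.root k) (l : ι) :
    P.pairingIn ℤ l k = P.pairingIn ℤ l i + P.pairingIn ℤ l j := by
  rw [P.pairingIn_comm l k, P.pairingIn_comm l i, P.pairingIn_comm l j, pairingIn_add_left h]

theorem pairingIn_eq_neg_one_of_add {i j k : ι} (h : P.root i + P.root j = P.root k) :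
    P.pairingIn ℤ i j = -1 := by
  have h₁ := pairingIn_add_left h k
  have h₂ := pairingIn_add_right h i
  have h₃ := pairingIn_add_right h j
  have h₄ := P.pairingIn_comm i j
  simp only [pairingIn_same] at *
  omega

theorem exists_add_of_pairingIn_eq_neg_one {i j : ι} (h : P.pairingIn ℤ i j = -1) :
    ∃ k, P.root i + P.root j = P.root k := by
  refine ⟨P.reflectionPerm j i, ?_⟩
  rw [root_reflectionPerm, reflection_apply_root' ℤ, h]
  simp

theorem root_reflectionPerm_self (i : ι) : P.root (P.reflectionPerm i i) = -P.root i := by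
  simp

theorem reflectionPerm_reflectionPerm_self (i : ι) :
    P.reflectionPerm (P.reflectionPerm i i) (P.reflectionPerm i i) = i :=
  P.root.injective <| by rw [root_reflectionPerm_self, root_reflectionPerm_self, neg_neg]

/-- In rank at least two, every root of an irreducible root system with roots of one length is a
sum of two roots. -/
theorem exists_add_eq [P.IsIrreducible] (hrank : 2 ≤ Module.finrank K V) (k : ι) :
    ∃ i j, P.root i + P.root j = P.root k := by
  by_contra! H
  -- A pairing `±1` would make `k + j` or `k - j` a root and so exhibit `k` as a sum. Every root is
  -- thus `±k` or orthogonal to `k`, and the line through `k` is stable under all reflections.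
  have key (j : ι) : P.root j ∈ Submodule.span K {P.root k} ∨ P.pairingIn ℤ k j = 0 := by
    have hle := P.pairingIn_mem_Icc k j
    obtain h | h | h | h | h : P.pairingIn ℤ k j = -2 ∨ P.pairingIn ℤ k j = -1 ∨
      P.pairingIn ℤ k j = 0 ∨ P.pairingIn ℤ k j = 1 ∨ P.pairingIn ℤ k j = 2 := by omega
    · left
      rw [eq_reflectionPerm_of_pairingIn_eq_neg_two h, root_reflectionPerm_self]
      exact neg_mem (Submodule.mem_span_singleton_self _)
    · obtain ⟨l, hl⟩ := exists_add_of_pairingIn_eq_neg_one h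
      refine absurd ?_ (H l (P.reflectionPerm j j))
      rw [root_reflectionPerm_self, ← hl, add_neg_cancel_right]
    · exact Or.inr h
    · obtain ⟨l, hl⟩ := exists_add_of_pairingIn_eq_neg_one (P := P) (i := k)
        (j := P.reflectionPerm j j) (by rw [pairingIn_reflectionPerm_self_right, h])
      refine absurd ?_ (H l j)
      rw [← hl, root_reflectionPerm_self, neg_add_cancel_right]
    · left
      rw [← eq_of_pairingIn_eq_two h]
      exact Submodule.mem_span_singleton_self _
  have htop : Submodule.span K {P.root k} = ⊤ := by
    refine IsIrreducible.eq_top_of_invtSubmodule_reflection (P := P) _ (fun j => ?_) ?_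
    · rw [Module.End.mem_invtSubmodule, Submodule.span_le, Set.singleton_subset_iff]
      simp only [Submodule.comap_coe, Set.mem_preimage, LinearEquiv.coe_coe, SetLike.mem_coe]
      rw [reflection_apply_root' ℤ]
      refine sub_mem (Submodule.mem_span_singleton_self _) ?_
      rcases key j with h | h
      · exact zsmul_mem h _
      · rw [h, zero_smul]
        exact zero_mem _
    · simpa using P.ne_zero k
  have := finrank_span_singleton (K := K) (P.ne_zero k)
  rw [htop, finrank_top] at this
  omega

/-- The graph on the roots with an edge wherever the difference is a root is connected. -/
theorem induction_on_pairingIn_eq_one [P.IsIrreducible] (hrank : 2 ≤ Module.finrank K V)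
    {p : ι → Prop} {i : ι} (hi : p i) (hp : ∀ i j, p i → P.pairingIn ℤ i j = 1 → p j) (j : ι) :
    p j := by
  -- With `k = a + b`, consecutive terms of `k, a, -b, -k` have pairing `1`.
  have hneg (k : ι) (hk : p k) : p (P.reflectionPerm k k) := by
    obtain ⟨a, b, hab⟩ := exists_add_eq (P := P) hrank k
    have h₁ := pairingIn_eq_neg_one_of_add hab
    have h₂ := pairingIn_add_left hab a
    have h₃ := pairingIn_add_right hab b
    have h₄ := P.pairingIn_comm a b
    simp only [pairingIn_same] at *
    have ha : p a := hp k a hk (by omega)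
    have hb : p (P.reflectionPerm b b) := hp a _ ha (by simp; omega)
    exact hp _ _ hb (by simp [h₃]; omega)
  have hstep (k l : ι) (hk : p k) (h : P.pairingIn ℤ k l ≠ 0) : p l := by
    have hle := P.pairingIn_mem_Icc k l
    obtain h | h | h | h : P.pairingIn ℤ k l = -2 ∨ P.pairingIn ℤ k l = -1 ∨
      P.pairingIn ℤ k l = 1 ∨ P.pairingIn ℤ k l = 2 := by omega
    · rw [eq_reflectionPerm_of_pairingIn_eq_neg_two h]
      exact hneg k hk
    · exact hp _ _ (hneg k hk) (by simp [h])
    · exact hp _ _ hk h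
    · exact eq_of_pairingIn_eq_two h ▸ hk
  by_contra hj
  -- Roots satisfying `p` are orthogonal to the others, so by irreducibility they span `V`. The
  -- coroot of `j` would then vanish on `V`, yet its value at the root `j` is `2`.
  have htop : Submodule.span K (P.root '' {k | p k}) = ⊤ := by
    refine span_root_image_eq_top_of_forall_orthogonal P _ ⟨i, hi⟩ fun l hl k hk => ?_
    have hl' : ¬ p l := fun h => hl (Submodule.subset_span ⟨l, h, rfl⟩)
    have h₀ : P.pairingIn ℤ k l = 0 := by
      by_contra h
      exact hl' (hstep k l hk h)
    rw [IsOrthogonal, ← P.algebraMap_pairingIn ℤ, ← P.algebraMap_pairingIn ℤ,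
      P.pairingIn_comm l k, h₀]
    simp
  have hker : Submodule.span K (P.root '' {k | p k}) ≤ LinearMap.ker (P.coroot' j) := by
    rw [Submodule.span_le]
    rintro _ ⟨k, hk, rfl⟩
    have h₀ : P.pairingIn ℤ k j = 0 := by
      by_contra h
      exact hj (hstep k j hk h)
    simp only [SetLike.mem_coe, LinearMap.mem_ker, root_coroot'_eq_pairing]
    rw [← P.algebraMap_pairingIn ℤ, h₀, map_zero]
  have : P.coroot' j (P.root j) = 0 := hker (htop ▸ Submodule.mem_top)
  simp at this

end RootPairing

/-! ### Structure constants are `±1` -/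

namespace ChevalleyBasis

variable {ι K V W L : Type*} [Finite ι] [Field K] [CharZero K] [AddCommGroup V] [Module K V]
  [AddCommGroup W] [Module K W] {P : RootPairing ι K V W} [P.IsCrystallographic] [P.IsReduced]
  [P.IsPairingSymm] [LieRing L] [LieAlgebra K L]

open RootPairing

theorem e_ne_zero (B : ChevalleyBasis P L) (i : ι) : B.e i ≠ 0 := by
  intro h
  have := B.bijective.1 (a₁ := (0, Finsupp.single i 1)) (a₂ := (0, 0)) (by simp [h])
  simpa using congrArg Prod.snd this

/-- Apply the Jacobi identity to `[e_{-i}, [e_i, e_j]]`. As `j - i` is neither a root nor zero, only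
the Cartan term survives; it equals `e_j` because the pairing is `-1`. Comparing coefficients gives
a product of two integers equal to `1`. -/
theorem isUnit_N (B : ChevalleyBasis P L) {i j k : ι} (h : P.root i + P.root j = P.root k) :
    IsUnit (B.N i j) := by
  set i' := P.reflectionPerm i i with hi'
  have hroot : P.root i' = -P.root i := root_reflectionPerm_self i
  have hij := pairingIn_eq_neg_one_of_add h
  have hnot : P.root i' + P.root j ∉ Set.range P.root := by
    rintro ⟨l, hl⟩
    have := pairingIn_eq_neg_one_of_add hl.symm
    rw [hi', pairingIn_reflectionPerm_self_left] at this
    omega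
  have hne : P.root i' + P.root j ≠ 0 := by
    intro h0
    rw [hroot, neg_add_eq_zero] at h0
    rw [P.root.injective h0, pairingIn_same] at hij
    omega
  have key : ⁅B.e i', ⁅B.e i, B.e j⁆⁆ = B.e j := by
    rw [leibniz_lie, B.lie_e_e_eq_zero i' j hne hnot, lie_zero, add_zero,
      B.lie_e_neg i' i (by rw [hroot, neg_neg]), B.lie_h_e, root'_coroot_eq_pairing,
      ← P.algebraMap_pairingIn ℤ, hi', pairingIn_reflectionPerm_self_right, P.pairingIn_comm, hij]
    simp
  rw [B.lie_e_e i j k h, lie_zsmul, B.lie_e_e i' k j (by rw [hroot, ← h]; abel), smul_smul] at key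
  have hmul : B.N i j * B.N i' k = 1 := by
    have h1 : ((B.N i j * B.N i' k : ℤ) : K) • B.e j = (1 : K) • B.e j := by
      rw [Int.cast_smul_eq_zsmul, key, one_smul]
    exact_mod_cast smul_left_injective K (B.e_ne_zero j) h1
  exact IsUnit.of_mul_eq_one _ hmul

end ChevalleyBasis

/-! ### Commutator identities in abstract groups -/

section Commutators

variable {G : Type*} [Group G] {g u v w y : G}

theorem Commute.commutatorElement_right (hu : Commute g u) (hv : Commute g v) :
    Commute g ⁅u, v⁆ := by
  rw [commutatorElement_def]
  exact ((hu.mul_right hv).mul_right hu.inv_right).mul_right hv.inv_right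

/-- If conjugation by `g` multiplies `u` by an element commuting with `u` and `v` and fixes `v`,
then `g` commutes with `⁅u, v⁆`. -/
theorem commute_commutatorElement_of_conj_left (hg : g * u * g⁻¹ = y * u) (hu : Commute y u)
    (hv : Commute y v) (hgv : Commute g v) : Commute g ⁅u, v⁆ := by
  rw [commute_iff_eq, ← mul_inv_eq_iff_eq_mul]
  change MulAut.conj g ⁅u, v⁆ = ⁅u, v⁆
  rw [map_commutatorElement, MulAut.conj_apply, MulAut.conj_apply, hg, hgv.eq,
    mul_inv_cancel_right, commutatorElement_def, mul_inv_rev, hu.eq]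
  rw [show u * y * v * (u⁻¹ * y⁻¹) * v⁻¹ = u * (y * v) * (y * u)⁻¹ * v⁻¹ by group, hv.eq, hu.eq,
    commutatorElement_def]
  group

theorem commute_commutatorElement_of_conj_right (hg : g * v * g⁻¹ = y * v) (hu : Commute y u)
    (hv : Commute y v) (hgu : Commute g u) : Commute g ⁅u, v⁆ := by
  rw [← commutatorElement_inv]
  exact (commute_commutatorElement_of_conj_left hg hv hu hgu).inv_right

theorem commutatorElement_commutatorElement_left (hu : Commute y u) (hv : y * v * y⁻¹ = w * v)
    (hw : Commute w ⁅u, v⁆) : ⁅⁅u, v⁆, y⁆ = ⁅u, w⁆⁻¹ := by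
  have h : y * ⁅u, v⁆ * y⁻¹ = ⁅u, w⁆ * ⁅u, v⁆ := by
    change MulAut.conj y ⁅u, v⁆ = _
    rw [map_commutatorElement, MulAut.conj_apply, MulAut.conj_apply, hv, hu.eq,
      mul_inv_cancel_right]
    have : ⁅u, w * v⁆ = ⁅u, w⁆ * (w * ⁅u, v⁆) * w⁻¹ := by
      simp only [commutatorElement_def]; group
    rw [this, hw.eq]
    group
  rw [commutatorElement_def ⁅u, v⁆ y, show ⁅u, v⁆ * y * ⁅u, v⁆⁻¹ * y⁻¹ =
    ⁅u, v⁆ * (y * ⁅u, v⁆ * y⁻¹)⁻¹ by group, h]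
  group

end Commutators

/-! ### Steinberg relations and centrality of `c_i(a, b)` when `a * b = 0` -/

namespace SteinbergGroup

open RootPairing

variable {ι K V W : Type*} [Finite ι] [Field K] [CharZero K] [AddCommGroup V] [Module K V]
  [AddCommGroup W] [Module K W] (P : RootPairing ι K V W) (N : ι → ι → ℤ)
  {R : Type*} [CommRing R]

theorem x_mul_x (i : ι) (a b : R) : x P N i a * x P N i b = x P N i (a + b) :=
  mul_inv_eq_one.mp (PresentedGroup.one_of_mem (SteinbergRel.add (P := P) (N := N) i a b))

theorem x_zero (i : ι) : x P N i (0 : R) = 1 := by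
  have := x_mul_x P N i (0 : R) 0
  rwa [add_zero, mul_eq_left] at this

theorem x_inv (i : ι) (a : R) : (x P N i a)⁻¹ = x P N i (-a) := by
  rw [inv_eq_iff_mul_eq_one, x_mul_x, add_neg_cancel, x_zero]

theorem commutator_x {i j k : ι} (h : P.root i + P.root j = P.root k) (a b : R) :
    ⁅x P N i a, x P N j b⁆ = x P N k (N i j * (a * b)) :=
  mul_inv_eq_one.mp (PresentedGroup.one_of_mem (SteinbergRel.comm (P := P) (N := N) i j k a b h))

theorem conj_x {i j k : ι} (h : P.root i + P.root j = P.root k) (a b : R) :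
    x P N i a * x P N j b * (x P N i a)⁻¹ = x P N k (N i j * (a * b)) * x P N j b := by
  rw [← commutator_x P N h, commutatorElement_def, inv_mul_cancel_right]

theorem closure_range_x :
    Subgroup.closure (Set.range fun p : ι × R => x P N p.1 p.2) = ⊤ :=
  PresentedGroup.closure_range_of _

theorem hom_ext {G : Type*} [Group G] {f g : SteinbergGroup P N R →* G}
    (h : ∀ i a, f (x P N i a) = g (x P N i a)) : f = g :=
  PresentedGroup.ext fun p => h p.1 p.2

/-- A subgroup generated by a set whose conjugates under the generators `x_i(a)` stay in the
subgroup is normal. -/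
theorem normal_closure_of_conj_x {T : Set (SteinbergGroup P N R)}
    (h : ∀ i a, ∀ g ∈ T, x P N i a * g * (x P N i a)⁻¹ ∈ Subgroup.closure T) :
    (Subgroup.closure T).Normal := by
  have hx (i : ι) (a : R) (g) (hg : g ∈ Subgroup.closure T) :
      x P N i a * g * (x P N i a)⁻¹ ∈ Subgroup.closure T :=
    (Subgroup.closure_le (K := (Subgroup.closure T).comap (MulAut.conj (x P N i a)).toMonoidHom)).2
      (h i a) hg
  have htop : (⊤ : Subgroup (SteinbergGroup P N R)) ≤ Subgroup.normalizer (Subgroup.closure T) := by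
    rw [← closure_range_x, Subgroup.closure_le]
    rintro _ ⟨⟨i, a⟩, rfl⟩
    refine Subgroup.mem_normalizer_iff.2 fun g => ⟨hx i a g, fun hg => ?_⟩
    have := hx i (-a) _ hg
    rw [← x_inv] at this
    convert this using 1
    group
  exact Subgroup.normalizer_eq_top_iff.1 (top_le_iff.1 htop)

theorem rel_normal (I : Ideal R) : (rel P N I).Normal :=
  MonoidHom.normal_ker _

theorem x_mem_rel {I : Ideal R} (i : ι) {a : R} (ha : a ∈ I) : x P N i a ∈ rel P N I := by
  rw [rel, MonoidHom.mem_ker, map_x, Ideal.Quotient.eq_zero_iff_mem.2 ha, x_zero]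

/-- `rel I` is the smallest normal subgroup containing the `x_i(a)` with `a ∈ I`. -/
theorem rel_le {I : Ideal R} {H : Subgroup (SteinbergGroup P N R)} [H.Normal]
    (h : ∀ i, ∀ a ∈ I, x P N i a ∈ H) : rel P N I ≤ H := by
  -- A set-theoretic section suffices: modulo `H`, `x_i(a)` depends only on the class of `a`, so the
  -- Steinberg relations hold for lifted coefficients.
  let lift : R ⧸ I → R := fun r => (Ideal.Quotient.mk_surjective r).choose
  have mk_lift (r : R ⧸ I) : Ideal.Quotient.mk I (lift r) = r :=
    (Ideal.Quotient.mk_surjective r).choose_spec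
  have hx {i : ι} {a b : R} (hab : Ideal.Quotient.mk I a = Ideal.Quotient.mk I b) :
      QuotientGroup.mk' H (x P N i a) = QuotientGroup.mk' H (x P N i b) := by
    refine QuotientGroup.eq.2 ?_
    rw [x_inv, x_mul_x]
    refine h i _ ?_
    rw [neg_add_eq_sub]
    exact Ideal.Quotient.eq.1 hab.symm
  let f : SteinbergGroup P N (R ⧸ I) →* SteinbergGroup P N R ⧸ H :=
    PresentedGroup.toGroup (f := fun p : ι × (R ⧸ I) => QuotientGroup.mk' H (x P N p.1 (lift p.2)))
      (by
        rintro _ (⟨i, a, b⟩ | ⟨i, j, k, a, b, hk⟩ | ⟨i, j, a, b, h0, hij⟩)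
        · simp only [map_mul, map_inv, FreeGroup.lift_apply_of]
          rw [← map_mul, x_mul_x, mul_inv_eq_one]
          exact hx (by simp only [map_add, mk_lift])
        · simp only [map_mul, map_inv, map_commutatorElement, FreeGroup.lift_apply_of]
          rw [← map_commutatorElement, commutator_x P N hk, mul_inv_eq_one]
          exact hx (by simp only [map_mul, mk_lift, map_intCast])
        · simp only [map_commutatorElement, FreeGroup.lift_apply_of]
          rw [← map_commutatorElement]
          have : ⁅x P N i (lift a), x P N j (lift b)⁆ = 1 :=
            PresentedGroup.one_of_mem (SteinbergRel.comm_one (P := P) (N := N) i j _ _ h0 hij)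
          rw [this, map_one])
  have hf : f.comp (map P N (Ideal.Quotient.mk I)) = QuotientGroup.mk' H := by
    refine hom_ext P N fun i a => ?_
    exact hx (mk_lift _)
  intro g hg
  rw [← QuotientGroup.eq_one_iff]
  change QuotientGroup.mk' H g = 1
  rw [← hf, MonoidHom.comp_apply, show map P N (Ideal.Quotient.mk I) g = 1 from hg, map_one]

variable [P.IsCrystallographic] [P.IsReduced] [P.IsPairingSymm]

theorem commute_x_of_nonneg {i j : ι} (h : 0 ≤ P.pairingIn ℤ i j) (a b : R) :
    Commute (x P N i a) (x P N j b) := by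
  have hle := P.pairingIn_mem_Icc i j
  rcases eq_or_ne i j with rfl | hne
  · rw [commute_iff_eq, x_mul_x, x_mul_x, add_comm]
  · rw [← commutatorElement_eq_one_iff_commute]
    refine PresentedGroup.one_of_mem (SteinbergRel.comm_one (P := P) (N := N) i j a b ?_ ?_)
    · intro h0
      have := (P.pairingIn_neg_two_neg_two_iff ℤ i j).2 (eq_neg_of_add_eq_zero_left h0)
      omega
    · rintro ⟨k, hk⟩
      have := pairingIn_eq_neg_one_of_add hk.symm
      omega

theorem commute_x_of_mul_eq_zero {i j : ι} (h : -1 ≤ P.pairingIn ℤ i j) {a b : R}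
    (hab : a * b = 0) : Commute (x P N i a) (x P N j b) := by
  rcases h.eq_or_lt with h | h
  · obtain ⟨k, hk⟩ := exists_add_of_pairingIn_eq_neg_one h.symm
    rw [← commutatorElement_eq_one_iff_commute, commutator_x P N hk, hab, mul_zero, x_zero]
  · exact commute_x_of_nonneg P N (by omega) a b

/-- Every root is a sum of two roots, and the structure constants are `±1`. -/
class IsSimplyLacedDatum : Prop where
  exists_add : ∀ k, ∃ i j, P.root i + P.root j = P.root k
  isUnit : ∀ i j k, P.root i + P.root j = P.root k → IsUnit (N i j)

variable [IsSimplyLacedDatum P N]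

/-- This serves to replace a root that is equal or opposite to a given one by two roots that are
neither. -/
theorem x_eq_commutator {i j k : ι} (h : P.root i + P.root j = P.root k) (a : R) :
    x P N k a = ⁅x P N i a, x P N j (N i j : R)⁆ := by
  have : (N i j : R) * N i j = 1 := by
    exact_mod_cast congrArg (Int.cast (R := R))
      (Int.isUnit_mul_self (IsSimplyLacedDatum.isUnit (P := P) i j k h))
  rw [commutator_x P N h, mul_left_comm, this, mul_one]

/-- If `a * b = 0`, then `c_i(a, b)` is central. -/
theorem commute_x_c (i l : ι) {a b : R} (hab : a * b = 0) (r : R) :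
    Commute (x P N l r) (c P N i a b) := by
  -- For `l ≠ ±i`, conjugation by `x_l(r)` alters at most one entry of the commutator, by a factor
  -- commuting with both entries since `a * b = 0`.
  have key (l : ι) (r : R) (h₁ : -2 < P.pairingIn ℤ l i) (h₂ : P.pairingIn ℤ l i < 2) :
      Commute (x P N l r) (c P N i a b) := by
    have hii := P.pairingIn_same (S := ℤ) i
    obtain h | h | h : P.pairingIn ℤ l i = -1 ∨ P.pairingIn ℤ l i = 0 ∨
      P.pairingIn ℤ l i = 1 := by omega
    · obtain ⟨k, hk⟩ := exists_add_of_pairingIn_eq_neg_one h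
      have hki := pairingIn_add_left hk i
      refine commute_commutatorElement_of_conj_left (conj_x P N hk r a) ?_ ?_ ?_
      · exact commute_x_of_nonneg P N (by omega) _ _
      · refine commute_x_of_mul_eq_zero P N ?_ ?_
        · rw [pairingIn_reflectionPerm_self_right]; omega
        · linear_combination (N l i * r : R) * hab
      · exact commute_x_of_nonneg P N (by rw [pairingIn_reflectionPerm_self_right]; omega) _ _
    · refine Commute.commutatorElement_right ?_ ?_
      · exact commute_x_of_nonneg P N (by omega) _ _
      · exact commute_x_of_nonneg P N (by rw [pairingIn_reflectionPerm_self_right]; omega) _ _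
    · obtain ⟨k, hk⟩ := exists_add_of_pairingIn_eq_neg_one (P := P) (i := l)
        (j := P.reflectionPerm i i) (by rw [pairingIn_reflectionPerm_self_right, h])
      have hki := pairingIn_add_left hk i
      rw [pairingIn_reflectionPerm_self_left] at hki
      refine commute_commutatorElement_of_conj_right (conj_x P N hk r b) ?_ ?_ ?_
      · refine commute_x_of_mul_eq_zero P N (by omega) ?_
        linear_combination (N l (P.reflectionPerm i i) * r : R) * hab
      · exact commute_x_of_nonneg P N (by rw [pairingIn_reflectionPerm_self_right]; omega) _ _
      · exact commute_x_of_nonneg P N (by omega) _ _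
  have hle := P.pairingIn_mem_Icc l i
  by_cases h : -2 < P.pairingIn ℤ l i ∧ P.pairingIn ℤ l i < 2
  · exact key l r h.1 h.2
  -- For `l = ±i`, write `x_l(r)` as a commutator over `l = d + e`; both `d` and `e` pair to `1`
  -- with `l`, so neither is `±i`.
  obtain ⟨d, e, hde⟩ := IsSimplyLacedDatum.exists_add (P := P) (N := N) l
  have hneg := pairingIn_eq_neg_one_of_add hde
  have hli := pairingIn_add_left hde i
  have hd := P.pairingIn_mem_Icc d i
  have he := P.pairingIn_mem_Icc e i
  have hne (m : ι) (hm : P.pairingIn ℤ m l = 1) :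
      -2 < P.pairingIn ℤ m i ∧ P.pairingIn ℤ m i < 2 := by
    obtain h | h : P.pairingIn ℤ l i = -2 ∨ P.pairingIn ℤ l i = 2 := by omega
    · rw [eq_reflectionPerm_of_pairingIn_eq_neg_two h, pairingIn_reflectionPerm_self_right]
      omega
    · rw [← eq_of_pairingIn_eq_two h]; omega
  have hdl := pairingIn_add_right hde d
  have hel := pairingIn_add_right hde e
  have hcomm := P.pairingIn_comm d e
  simp only [pairingIn_same] at hdl hel
  have hd' := hne d (by omega)
  have he' := hne e (by omega)
  rw [x_eq_commutator P N hde]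
  exact (Commute.commutatorElement_right (key d r hd'.1 hd'.2).symm
    (key e _ he'.1 he'.2).symm).symm

theorem c_mem_center (i : ι) {a b : R} (hab : a * b = 0) :
    c P N i a b ∈ Subgroup.center (SteinbergGroup P N R) := by
  have : (⊤ : Subgroup (SteinbergGroup P N R)) ≤ Subgroup.centralizer {c P N i a b} := by
    rw [← closure_range_x, Subgroup.closure_le]
    rintro _ ⟨⟨l, r⟩, rfl⟩
    exact Subgroup.mem_centralizer_singleton_iff.2 (commute_x_c P N i l hab r).eq
  exact Subgroup.mem_center_iff.2 fun g =>
    Subgroup.mem_centralizer_singleton_iff.1 (this (Subgroup.mem_top g))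

/-- If `a * b = 0`, then `c_k(a, b)` and `c_i(a, ± b)` are mutually inverse when the difference of
the roots `k` and `i` is a root. -/
theorem c_eq_inv_c {i j k : ι} (h : P.root i + P.root j = P.root k) {a b : R} (hab : a * b = 0) :
    c P N k a b =
      (c P N i a (N (P.reflectionPerm k k) j * (b * N i j)))⁻¹ := by
  have hij := pairingIn_eq_neg_one_of_add h
  have hki := pairingIn_add_left h i
  have hcomm := P.pairingIn_comm i j
  have hik := P.pairingIn_comm i k
  simp only [pairingIn_same] at hki
  have hroot : P.root (P.reflectionPerm k k) + P.root j = P.root (P.reflectionPerm i i) := by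
    rw [root_reflectionPerm_self, root_reflectionPerm_self, ← h]; abel
  conv_lhs => rw [c, x_eq_commutator P N h]
  -- Here `x_k(a)` has become `[x_i(a), x_j(±1)]`. As `a * b = 0`, `x_{-k}(b)` commutes with
  -- `x_i(a)`, while conjugating `x_j` by it creates a factor at `-k + j = -i`.
  refine commutatorElement_commutatorElement_left ?_ (conj_x P N hroot _ _) ?_
  · refine commute_x_of_mul_eq_zero P N ?_ (by rw [mul_comm, hab])
    rw [pairingIn_reflectionPerm_self_left]; omega
  · rw [← x_eq_commutator P N h]
    refine commute_x_of_mul_eq_zero P N ?_ ?_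
    · rw [pairingIn_reflectionPerm_self_left]; omega
    · linear_combination (N (P.reflectionPerm k k) j * N i j : R) * hab

end SteinbergGroup

/-! ### Generators `z_i(s, a)` of relative groups, and commutation of annihilating ideals -/

namespace SteinbergGroup

open RootPairing

variable {ι K V W : Type*} [Finite ι] [Field K] [CharZero K] [AddCommGroup V] [Module K V]
  [AddCommGroup W] [Module K W] (P : RootPairing ι K V W) (N : ι → ι → ℤ)
  {R : Type*} [CommRing R]

/-- `z_i(s, a)`, the conjugate of `x_i(s)` by `x_{-i}(a)`. -/
def z (i : ι) (s a : R) : SteinbergGroup P N R :=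
  MulAut.conj (x P N (P.reflectionPerm i i) a) (x P N i s)

/-- The subgroup generated by the `x_i(s)` with `s ∈ I`. -/
def elem (I : Ideal R) : Subgroup (SteinbergGroup P N R) :=
  Subgroup.closure {g | ∃ i, ∃ s ∈ I, g = x P N i s}

/-- The subgroup generated by the `z_i(s, a)` with `s ∈ I` and `a ∈ R`. -/
def zClosure (I : Ideal R) : Subgroup (SteinbergGroup P N R) :=
  Subgroup.closure {g | ∃ i, ∃ s ∈ I, ∃ a, g = z P N i s a}

variable {P N} {I J : Ideal R}

theorem x_mem_elem (i : ι) {s : R} (hs : s ∈ I) : x P N i s ∈ elem P N I :=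
  Subgroup.subset_closure ⟨i, s, hs, rfl⟩

theorem z_mem_zClosure (i : ι) {s : R} (hs : s ∈ I) (a : R) : z P N i s a ∈ zClosure P N I :=
  Subgroup.subset_closure ⟨i, s, hs, a, rfl⟩

theorem x_mem_zClosure (i : ι) {s : R} (hs : s ∈ I) : x P N i s ∈ zClosure P N I := by
  simpa [z, x_zero] using z_mem_zClosure (P := P) (N := N) i hs 0

theorem elem_le_zClosure : elem P N I ≤ zClosure P N I := by
  rw [elem, Subgroup.closure_le]
  rintro _ ⟨i, s, hs, rfl⟩
  exact x_mem_zClosure i hs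

theorem conj_x_add {i j k : ι} (h : P.root i + P.root j = P.root k) (a b : R) :
    MulAut.conj (x P N i a) (x P N j b) = x P N k (N i j * (a * b)) * x P N j b :=
  conj_x P N h a b

theorem _root_.Commute.conj_eq {G : Type*} [Group G] {g h : G} (hgh : Commute g h) :
    MulAut.conj g h = h := by
  rw [MulAut.conj_apply, hgh.eq, mul_inv_cancel_right]

variable [P.IsCrystallographic] [P.IsReduced] [P.IsPairingSymm]

theorem conj_x_of_nonneg {i j : ι} (h : 0 ≤ P.pairingIn ℤ i j) (a b : R) :
    MulAut.conj (x P N i a) (x P N j b) = x P N j b :=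
  (commute_x_of_nonneg P N h a b).conj_eq

theorem conj_x_mem_elem {l j : ι} (h : -1 ≤ P.pairingIn ℤ l j) (r : R) {s : R} (hs : s ∈ I) :
    MulAut.conj (x P N l r) (x P N j s) ∈ elem P N I := by
  rcases h.eq_or_lt with h | h
  · obtain ⟨k, hk⟩ := exists_add_of_pairingIn_eq_neg_one h.symm
    rw [conj_x_add hk]
    exact mul_mem (x_mem_elem k (I.mul_mem_left _ (I.mul_mem_left _ hs))) (x_mem_elem j hs)
  · rw [conj_x_of_nonneg (by omega)]
    exact x_mem_elem j hs

theorem conj_elem_mem_zClosure (l : ι) (r : R) {g : SteinbergGroup P N R}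
    (hg : g ∈ elem P N I) : MulAut.conj (x P N l r) g ∈ zClosure P N I := by
  suffices elem P N I ≤ (zClosure P N I).comap (MulAut.conj (x P N l r)).toMonoidHom from this hg
  rw [elem, Subgroup.closure_le]
  rintro _ ⟨j, s, hs, rfl⟩
  change MulAut.conj (x P N l r) (x P N j s) ∈ zClosure P N I
  have hle := P.pairingIn_mem_Icc j l
  have hcomm := P.pairingIn_comm j l
  by_cases h : P.pairingIn ℤ j l = -2
  · rw [eq_reflectionPerm_of_pairingIn_eq_neg_two h]
    exact z_mem_zClosure j hs r
  · exact elem_le_zClosure (conj_x_mem_elem (by omega) r hs)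

/-- The correction is kept as an explicit left factor in `elem` because a further conjugation sends
`elem` into `zClosure`. -/
theorem conj_z_of_ne {l i : ι} (h₁ : -2 < P.pairingIn ℤ l i) (h₂ : P.pairingIn ℤ l i < 2) (r : R)
    {s : R} (hs : s ∈ I) (a : R) :
    ∃ d ∈ elem P N I, MulAut.conj (x P N l r) (z P N i s a) = d * z P N i s a := by
  have hii := P.pairingIn_same (S := ℤ) i
  obtain h | h | h : P.pairingIn ℤ l i = -1 ∨ P.pairingIn ℤ l i = 0 ∨
    P.pairingIn ℤ l i = 1 := by omega
  · obtain ⟨k, hk⟩ := exists_add_of_pairingIn_eq_neg_one h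
    have hki := pairingIn_add_left hk i
    have hik := P.pairingIn_comm i k
    refine ⟨MulAut.conj (x P N (P.reflectionPerm i i) a) (x P N k (N l i * (r * s))),
      conj_x_mem_elem ?_ _ (I.mul_mem_left _ (I.mul_mem_left _ hs)), ?_⟩
    · rw [pairingIn_reflectionPerm_self_left]; omega
    · have hc : Commute (x P N l r) (x P N (P.reflectionPerm i i) a) :=
        commute_x_of_nonneg P N (by rw [pairingIn_reflectionPerm_self_right]; omega) _ _
      rw [z, ← map_mul, ← conj_x_add hk, ← MulAut.mul_apply, ← MulAut.mul_apply, ← map_mul,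
        ← map_mul, hc.eq]
  · refine ⟨1, one_mem _, ?_⟩
    rw [one_mul, z, ← MulAut.mul_apply, ← map_mul, (commute_x_of_nonneg P N (by
      rw [pairingIn_reflectionPerm_self_right]; omega) r a :
      Commute (x P N l r) (x P N (P.reflectionPerm i i) a)).eq, map_mul, MulAut.mul_apply,
      conj_x_of_nonneg (by omega)]
  -- Moving `x_l` past `x_{-i}(a)` creates a factor at `k = l - i`; acting on `x_i(s)`, that factor
  -- produces one at `k + i = l`.
  · obtain ⟨k, hk⟩ := exists_add_of_pairingIn_eq_neg_one (P := P) (i := l)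
      (j := P.reflectionPerm i i) (by rw [pairingIn_reflectionPerm_self_right, h])
    have hki := pairingIn_add_left hk i
    rw [pairingIn_reflectionPerm_self_left] at hki
    have hkil : P.root k + P.root i = P.root l := by
      rw [← hk, root_reflectionPerm_self, neg_add_cancel_right]
    set t : R := N l (P.reflectionPerm i i) * (r * a) with ht
    refine ⟨MulAut.conj (x P N (P.reflectionPerm i i) a) (x P N l (N k i * (t * s))),
      conj_x_mem_elem ?_ _ (I.mul_mem_left _ (I.mul_mem_left _ hs)), ?_⟩
    · rw [pairingIn_reflectionPerm_self_left, P.pairingIn_comm i l]; omega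
    · have hc : Commute (x P N k t) (x P N (P.reflectionPerm i i) a) :=
        commute_x_of_nonneg P N (by rw [pairingIn_reflectionPerm_self_right]; omega) _ _
      have hswap : x P N l r * x P N (P.reflectionPerm i i) a =
          x P N (P.reflectionPerm i i) a * x P N k t * x P N l r := by
        rw [← hc.eq, ← mul_inv_eq_iff_eq_mul, conj_x P N hk]
      rw [z, ← map_mul, ← conj_x_add hkil, ← MulAut.mul_apply, ← MulAut.mul_apply, ← map_mul,
        ← map_mul, hswap, map_mul _ _ (x P N l r), MulAut.mul_apply, conj_x_of_nonneg (by omega)]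

theorem conj_z_mem_zClosure_of_ne {l i : ι} (h : l ≠ i) (r : R) {s : R} (hs : s ∈ I) (a : R) :
    MulAut.conj (x P N l r) (z P N i s a) ∈ zClosure P N I := by
  have hle := P.pairingIn_mem_Icc l i
  have hcomm := P.pairingIn_comm i l
  have h2 : P.pairingIn ℤ l i ≠ 2 := fun h' => h (eq_of_pairingIn_eq_two h')
  by_cases h' : P.pairingIn ℤ i l = -2
  · rw [eq_reflectionPerm_of_pairingIn_eq_neg_two h', z, ← MulAut.mul_apply, ← map_mul, x_mul_x]
    exact z_mem_zClosure i hs _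
  · obtain ⟨d, hd, hdz⟩ := conj_z_of_ne (P := P) (N := N) (l := l) (i := i) (by omega)
      (by omega) r hs a
    rw [hdz]
    exact mul_mem (elem_le_zClosure hd) (z_mem_zClosure i hs a)

variable [IsSimplyLacedDatum P N]

/-- This is the hard conjugation. With `i = d + e`, expanding `x_i(s)` as a commutator turns `z_i(s,
a)` into `p q p⁻¹ q⁻¹`, where `p = x_{-e}(t) x_d(s)` lies in `elem` and `q = x_{-d}(n₁) x_e(n₂)`.
Conjugating the factors of `p` by `q` yields only `z_d`, `z_{-e}` and `elem` terms, which `x_i(r)`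
keeps in `zClosure`. -/
theorem conj_z_self_mem_zClosure (i : ι) (r : R) {s : R} (hs : s ∈ I) (a : R) :
    MulAut.conj (x P N i r) (z P N i s a) ∈ zClosure P N I := by
  obtain ⟨d, e, hde⟩ := IsSimplyLacedDatum.exists_add (P := P) (N := N) i
  have hneg := pairingIn_eq_neg_one_of_add hde
  have hid := pairingIn_add_left hde d
  have hie := pairingIn_add_left hde e
  have hdi := P.pairingIn_comm i d
  have hei := P.pairingIn_comm i e
  have hcomm := P.pairingIn_comm d e
  simp only [pairingIn_same] at hid hie
  set i' := P.reflectionPerm i i with hi'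
  set d' := P.reflectionPerm d d with hd'
  set e' := P.reflectionPerm e e with he'
  have hroot₁ : P.root i' + P.root d = P.root e' := by
    rw [hi', he', root_reflectionPerm_self, root_reflectionPerm_self, ← hde]; abel
  have hroot₂ : P.root i' + P.root e = P.root d' := by
    rw [hi', hd', root_reflectionPerm_self, root_reflectionPerm_self, ← hde]; abel
  have hed : P.root e + P.root d = P.root i := by rw [add_comm, hde]
  have hee : P.reflectionPerm e' e' = e := reflectionPerm_reflectionPerm_self e
  set n₁ : R := N i' e * (a * N d e)
  set n₂ : R := (N d e : R)
  set f := MulAut.conj (x P N i r) * (MulAut.conj (x P N d' n₁) * MulAut.conj (x P N e n₂)) with hf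
  have conj_d (t : R) (ht : t ∈ I) : f (x P N d t) ∈ zClosure P N I := by
    rw [hf, MulAut.mul_apply, MulAut.mul_apply, conj_x_add hed, map_mul, map_mul]
    refine mul_mem (conj_elem_mem_zClosure _ _ (conj_x_mem_elem ?_ _
      (I.mul_mem_left _ (I.mul_mem_left _ ht)))) (conj_z_mem_zClosure_of_ne ?_ _ ht _)
    · rw [hd', pairingIn_reflectionPerm_self_left]; omega
    · rintro rfl; simp at hid; omega
  have conj_e (t : R) (ht : t ∈ I) : f (x P N e' t) ∈ zClosure P N I := by
    have hz : MulAut.conj (x P N e n₂) (x P N e' t) = z P N e' t n₂ := by rw [z, hee]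
    obtain ⟨u, hu, huz⟩ := conj_z_of_ne (P := P) (N := N) (I := I) (l := d') (i := e')
      (by simp [hd', he']; omega) (by simp [hd', he']; omega) n₁ ht n₂
    rw [hf, MulAut.mul_apply, MulAut.mul_apply, hz, huz, map_mul]
    refine mul_mem (conj_elem_mem_zClosure _ _ hu) (conj_z_mem_zClosure_of_ne ?_ _ ht _)
    intro h
    have : P.pairingIn ℤ i e = P.pairingIn ℤ e' e := by rw [h]
    rw [he', pairingIn_reflectionPerm_self_left, pairingIn_same] at this
    omega
  rw [z, x_eq_commutator P N hde s, map_commutatorElement, conj_x_add hroot₁, conj_x_add hroot₂,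
    commutatorElement_def]
  set t : R := N i' d * (a * s) with ht
  have htI : t ∈ I := I.mul_mem_left _ (I.mul_mem_left _ hs)
  have hrest : MulAut.conj (x P N i r) (x P N d' n₁ * x P N e n₂ * (x P N e' t * x P N d s)⁻¹ *
      (x P N d' n₁ * x P N e n₂)⁻¹) = (f (x P N e' t) * f (x P N d s))⁻¹ := by
    rw [← map_mul f, ← map_inv f, hf, ← map_mul MulAut.conj (x P N d' n₁), MulAut.mul_apply,
      MulAut.conj_apply (x P N d' n₁ * x P N e n₂)]
  rw [mul_assoc, mul_assoc, ← mul_assoc (x P N d' n₁ * x P N e n₂), map_mul, hrest]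
  exact mul_mem (conj_elem_mem_zClosure _ _ (mul_mem (x_mem_elem _ htI) (x_mem_elem _ hs)))
    (inv_mem (mul_mem (conj_e t htI) (conj_d s hs)))

theorem zClosure_normal : (zClosure P N I).Normal := by
  refine normal_closure_of_conj_x P N ?_
  rintro l r _ ⟨i, s, hs, a, rfl⟩
  change MulAut.conj (x P N l r) (z P N i s a) ∈ zClosure P N I
  rcases eq_or_ne l i with rfl | h
  · exact conj_z_self_mem_zClosure l r hs a
  · exact conj_z_mem_zClosure_of_ne h r hs a

/-- The relative Steinberg group is generated by the elements `z_i(s, a)` with `s ∈ I`. -/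
theorem rel_eq_zClosure : rel P N I = zClosure P N I := by
  have := zClosure_normal (P := P) (N := N) (I := I)
  refine le_antisymm (rel_le P N fun i a ha => x_mem_zClosure i ha) ?_
  rw [zClosure, Subgroup.closure_le]
  rintro _ ⟨i, s, hs, a, rfl⟩
  exact (rel_normal P N I).conj_mem _ (x_mem_rel P N i hs) (x P N (P.reflectionPerm i i) a)

section CentralQuotient

variable {Q : Type*} [Group Q] {φ : SteinbergGroup P N R →* Q}

/-- Only opposite roots can obstruct commutation, and there the commutator is a `c_i(s, t)`, killed
by `φ`. -/
theorem commute_map_elem (hIJ : ∀ s ∈ I, ∀ t ∈ J, s * t = 0)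
    (hφ : ∀ i, ∀ s ∈ I, ∀ t ∈ J, φ (c P N i s t) = 1) {g h : SteinbergGroup P N R}
    (hg : g ∈ elem P N I) (hh : h ∈ elem P N J) : Commute (φ g) (φ h) := by
  have key (i j : ι) (s t : R) (hs : s ∈ I) (ht : t ∈ J) :
      Commute (φ (x P N i s)) (φ (x P N j t)) := by
    have hle := P.pairingIn_mem_Icc i j
    by_cases h : P.pairingIn ℤ i j = -2
    · rw [← commutatorElement_eq_one_iff_commute, ← map_commutatorElement,
        eq_reflectionPerm_of_pairingIn_eq_neg_two h]
      exact hφ i s hs t ht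
    · exact (commute_x_of_mul_eq_zero P N (by omega) (hIJ s hs t ht)).map φ
  have h₁ (j : ι) (t : R) (ht : t ∈ J) :
      elem P N I ≤ (Subgroup.centralizer {φ (x P N j t)}).comap φ := by
    rw [elem, Subgroup.closure_le]
    rintro _ ⟨i, s, hs, rfl⟩
    exact Subgroup.mem_centralizer_singleton_iff.2 (key i j s t hs ht).eq
  have h₂ : elem P N J ≤ (Subgroup.centralizer {φ g}).comap φ := by
    rw [elem, Subgroup.closure_le]
    rintro _ ⟨j, t, ht, rfl⟩
    exact Subgroup.mem_centralizer_singleton_iff.2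
      (Subgroup.mem_centralizer_singleton_iff.1 (h₁ j t ht hg)).symm
  exact (Subgroup.mem_centralizer_singleton_iff.1 (h₂ hh)).symm

theorem _root_.commute_map_conj_iff {G H : Type*} [Group G] [Group H] (φ : G →* H) (k g h : G) :
    Commute (φ (MulAut.conj k g)) (φ h) ↔ Commute (φ g) (φ (MulAut.conj k⁻¹ h)) := by
  simp only [commute_iff_eq, ← map_mul]
  simp only [MulAut.conj_apply, map_mul, map_inv]
  constructor <;> intro h'
  · have := congrArg (fun y => (φ k)⁻¹ * y * φ k) h'
    simpa [mul_assoc] using this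
  · have := congrArg (fun y => φ k * y * (φ k)⁻¹) h'
    simpa [mul_assoc] using this

/-- If `I` and `J` annihilate each other and `φ` kills the elements `c_i(s, t)`, `s ∈ I`, `t ∈ J`,
then the images of `rel I` and of the `x_j(t)` with `t ∈ J` commute. -/
theorem commute_map_rel_x (hIJ : ∀ s ∈ I, ∀ t ∈ J, s * t = 0)
    (hφ : ∀ i, ∀ s ∈ I, ∀ t ∈ J, φ (c P N i s t) = 1) {g : SteinbergGroup P N R}
    (hg : g ∈ rel P N I) (j : ι) {t : R} (ht : t ∈ J) : Commute (φ g) (φ (x P N j t)) := by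
  suffices rel P N I ≤ (Subgroup.centralizer {φ (x P N j t)}).comap φ from
    Subgroup.mem_centralizer_singleton_iff.1 (this hg)
  rw [rel_eq_zClosure, zClosure, Subgroup.closure_le]
  rintro _ ⟨i, s, hs, a, rfl⟩
  refine Subgroup.mem_centralizer_singleton_iff.2 (Commute.eq ?_)
  have hle := P.pairingIn_mem_Icc i j
  by_cases h : P.pairingIn ℤ i j = 2
  swap
  -- When `j ≠ i`, the conjugation can be moved onto `x_j(t)` without leaving `elem J`.
  · rw [z, commute_map_conj_iff, x_inv]
    refine commute_map_elem hIJ hφ (x_mem_elem i hs) (conj_x_mem_elem ?_ _ ht)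
    rw [pairingIn_reflectionPerm_self_left]; omega
  obtain rfl := eq_of_pairingIn_eq_two h
  -- When `j = i`, `z_i(s, a)` becomes `u (q u⁻¹ q⁻¹)` with `u` in `elem I` and `q` a product over
  -- the roots `-d` and `e`. Moving `q` onto `x_i(t)` stays in `elem J`, no opposite roots being
  -- met.
  obtain ⟨d, e, hde⟩ := IsSimplyLacedDatum.exists_add (P := P) (N := N) i
  have hneg := pairingIn_eq_neg_one_of_add hde
  have hid := pairingIn_add_left hde d
  have hie := pairingIn_add_left hde e
  have hdi := P.pairingIn_comm i d
  have hei := P.pairingIn_comm i e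
  have hcomm := P.pairingIn_comm d e
  simp only [pairingIn_same] at hid hie
  set i' := P.reflectionPerm i i with hi'
  set d' := P.reflectionPerm d d with hd'
  have hroot₂ : P.root i' + P.root e = P.root d' := by
    rw [hi', hd', root_reflectionPerm_self, root_reflectionPerm_self, ← hde]; abel
  have hroot₃ : P.root d' + P.root i = P.root e := by
    rw [hd', root_reflectionPerm_self, ← hde]; abel
  rw [z, x_eq_commutator P N hde s, map_commutatorElement, conj_x_add hroot₂]
  set u := MulAut.conj (x P N i' a) (x P N d s) with hu
  have hu_mem : u ∈ elem P N I := by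
    refine conj_x_mem_elem ?_ _ hs
    rw [hi', pairingIn_reflectionPerm_self_left]; omega
  rw [commutatorElement_def, mul_assoc, mul_assoc, ← mul_assoc (x P N d' _ * _), map_mul]
  refine (commute_map_elem hIJ hφ hu_mem (x_mem_elem i ht)).mul_left ?_
  rw [← MulAut.conj_apply, commute_map_conj_iff]
  refine commute_map_elem hIJ hφ (inv_mem hu_mem) ?_
  rw [mul_inv_rev, x_inv, x_inv, map_mul, MulAut.mul_apply, conj_x_add hroot₃, map_mul]
  exact mul_mem (conj_x_mem_elem (by simp) _ (J.mul_mem_left _ (J.mul_mem_left _ ht)))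
    (conj_x_mem_elem (by omega) _ ht)

end CentralQuotient

end SteinbergGroup

/-! ### Reduction modulo `X M[X]` and the kernel of evaluation -/

theorem Subgroup.closure_ker_union {G H : Type*} [Group G] [Group H] (f : G →* H) (T : Set G) :
    Subgroup.closure ((f.ker : Set G) ∪ T) = (Subgroup.closure (f '' T)).comap f := by
  rw [Subgroup.closure_union, Subgroup.closure_eq, ← MonoidHom.map_closure, Subgroup.comap_map_eq,
    sup_comm]

theorem Polynomial.sub_C_coeff_zero_mem {A : Type*} [CommRing A] {M : Ideal A} {s : A[X]}
    (hs : s ∈ M.map (C : A →+* A[X])) :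
    s - C (s.coeff 0) ∈ Ideal.span {X} * M.map (C : A →+* A[X]) := by
  have h : s - C (s.coeff 0) = X * s.divX := by
    rw [sub_eq_iff_eq_add, X_mul_divX_add]
  rw [h]
  refine Ideal.mul_mem_mul (Ideal.mem_span_singleton_self X) (Ideal.mem_map_C_iff.2 fun n => ?_)
  rw [coeff_divX]
  exact Ideal.mem_map_C_iff.1 hs _

namespace SteinbergGroup

open RootPairing

variable {ι K V W : Type*} [Finite ι] [Field K] [CharZero K] [AddCommGroup V] [Module K V]
  [AddCommGroup W] [Module K W] (P : RootPairing ι K V W) (N : ι → ι → ℤ)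
  {A : Type*} [CommRing A] {M : Ideal A}

theorem map_c {R S : Type*} [CommRing R] [CommRing S] (f : R →+* S) (i : ι) (s t : R) :
    map P N f (c P N i s t) = c P N i (f s) (f t) := by
  simp only [c, map_commutatorElement, map_x]

theorem mem_evalKer {w : SteinbergGroup P N A[X]} :
    w ∈ evalKer P N A M ↔
      w ∈ rel P N (M.map (C : A →+* A[X])) ∧ map P N (evalRingHom (0 : A)) w = 1 := by
  simp only [evalKer, Subgroup.mem_map, MonoidHom.mem_ker, Subgroup.coe_subtype]
  constructor
  · rintro ⟨v, hv, rfl⟩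
    exact ⟨v.2, congrArg Subtype.val hv⟩
  · rintro ⟨h, hw⟩
    exact ⟨⟨w, h⟩, Subtype.ext hw, rfl⟩

theorem rel_le_evalKer :
    rel P N (Ideal.span {X} * M.map (C : A →+* A[X])) ≤ evalKer P N A M := by
  intro w hw
  refine (mem_evalKer P N).2 ⟨?_, ?_⟩
  · have := rel_normal P N (M.map (C : A →+* A[X]))
    have hle : Ideal.span {(X : A[X])} * M.map (C : A →+* A[X]) ≤ M.map (C : A →+* A[X]) :=
      Ideal.mul_le_right
    exact rel_le P N (fun i a ha => x_mem_rel P N i (hle ha)) hw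
  · have hker : (map P N (evalRingHom (0 : A))).ker.Normal := MonoidHom.normal_ker _
    have hle : Ideal.span {(X : A[X])} * M.map (C : A →+* A[X]) ≤ Ideal.span {(X : A[X])} :=
      Ideal.mul_le_left
    refine rel_le P N (H := (map P N (evalRingHom (0 : A))).ker) (fun i a ha => ?_) hw
    obtain ⟨q, rfl⟩ := Ideal.mem_span_singleton'.1 (hle ha)
    rw [MonoidHom.mem_ker, map_x]
    simp [x_zero]

theorem c_mem_evalKer (i : ι) {m : A} (hm : m ∈ M) (ξ : A[X]) :
    c P N i (C m) (X * ξ) ∈ evalKer P N A M := by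
  refine (mem_evalKer P N).2 ⟨?_, ?_⟩
  · have := rel_normal P N (M.map (C : A →+* A[X]))
    have hx := x_mem_rel P N i (Ideal.mem_map_of_mem (C : A →+* A[X]) hm)
    rw [c, commutatorElement_def, mul_assoc, mul_assoc]
    refine mul_mem hx ?_
    rw [← mul_assoc]
    exact this.conj_mem _ (inv_mem hx) _
  · rw [map_c]
    simp [c, x_zero]

variable (A M) in
/-- The elements `c_i(m, X ξ)` with `m ∈ M`, for a fixed root `i`. -/
def cSet (i : ι) : Set (SteinbergGroup P N A[X]) :=
  {g | ∃ (m : A) (ξ : A[X]), m ∈ M ∧ g = c P N i (C m) (X * ξ)}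

variable (A M) in
/-- Reduction of coefficients modulo `X M[X]`. -/
noncomputable def reduction : SteinbergGroup P N A[X] →*
    SteinbergGroup P N (A[X] ⧸ (Ideal.span {X} * M.map (C : A →+* A[X]))) :=
  map P N (Ideal.Quotient.mk _)

theorem mk_eq_mk_C_coeff_zero {s : A[X]} (hs : s ∈ M.map (C : A →+* A[X])) :
    Ideal.Quotient.mk (Ideal.span {X} * M.map (C : A →+* A[X])) s =
      Ideal.Quotient.mk _ (C (s.coeff 0)) := by
  rw [Ideal.Quotient.eq]
  exact sub_C_coeff_zero_mem hs

theorem mk_mul_mk_eq_zero {s t : A[X]} (hs : s ∈ M.map (C : A →+* A[X]))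
    (ht : t ∈ Ideal.span {(X : A[X])}) :
    Ideal.Quotient.mk (Ideal.span {X} * M.map (C : A →+* A[X])) s * Ideal.Quotient.mk _ t = 0 := by
  rw [← map_mul, Ideal.Quotient.eq_zero_iff_mem, mul_comm s t]
  exact Ideal.mul_mem_mul ht hs

variable [P.IsCrystallographic] [P.IsReduced] [P.IsPairingSymm] [IsSimplyLacedDatum P N]

/-- `c_eq_inv_c` passes from `γ` to any root along pairs with pairing `1`; the signs are absorbed
into `ξ`. -/
theorem reduction_c_mem_closure_cSet [P.IsIrreducible] (hrank : 2 ≤ Module.finrank K V) (γ i : ι)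
    {m : A} (hm : m ∈ M) (ξ : A[X]) :
    reduction P N A M (c P N i (C m) (X * ξ)) ∈
      Subgroup.closure (reduction P N A M '' cSet P N A M γ) := by
  revert m ξ
  refine induction_on_pairingIn_eq_one (P := P) hrank
    (p := fun i => ∀ {m : A} (_ : m ∈ M) (ξ : A[X]), reduction P N A M (c P N i (C m) (X * ξ)) ∈
      Subgroup.closure (reduction P N A M '' cSet P N A M γ)) (i := γ)
    (fun {m} hm ξ => Subgroup.subset_closure ⟨_, ⟨m, ξ, hm, rfl⟩, rfl⟩) (fun i k hi hik => ?_) i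
  intro m hm ξ
  obtain ⟨j, hj⟩ := exists_add_of_pairingIn_eq_neg_one (P := P) (i := k)
    (j := P.reflectionPerm i i)
    (by rw [pairingIn_reflectionPerm_self_right, P.pairingIn_comm, hik])
  have hroot : P.root i + P.root j = P.root k := by
    rw [← hj, root_reflectionPerm_self]; abel
  have hmul := mk_mul_mk_eq_zero (Ideal.mem_map_of_mem (C : A →+* A[X]) hm)
    (Ideal.mul_mem_right ξ (Ideal.span {(X : A[X])}) (Ideal.mem_span_singleton_self X))
  have := hi hm (N (P.reflectionPerm k k) j * (ξ * N i j))
  rw [reduction, map_c] at this ⊢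
  rw [c_eq_inv_c P N hroot hmul]
  have hsign : (N (P.reflectionPerm k k) j : A[X] ⧸ (Ideal.span {X} * M.map (C : A →+* A[X]))) *
      (Ideal.Quotient.mk _ (X * ξ) * (N i j : A[X] ⧸ _)) =
        Ideal.Quotient.mk _
          (X * ((N (P.reflectionPerm k k) j : A[X]) * (ξ * (N i j : A[X])))) := by
    simp only [map_mul, map_intCast]
    ring
  rw [hsign]
  exact inv_mem this

/-- Let `π` annihilate `X M[X]`. If a central subgroup `E` contains all `c_i(π m, π (X ξ))` with
`m ∈ M`, then every element of `rel M[X]` is congruent modulo `E` to one coming from `St(A)`. -/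
theorem exists_map_C_of_mem_rel {R : Type*} [CommRing R] {π : A[X] →+* R}
    (hsurj : Function.Surjective π)
    (hcoeff : ∀ s ∈ M.map (C : A →+* A[X]), π s = π (C (s.coeff 0)))
    (hmul : ∀ s ∈ M.map (C : A →+* A[X]), ∀ t ∈ Ideal.span {(X : A[X])}, π s * π t = 0)
    {E : Subgroup (SteinbergGroup P N R)} (hE : E ≤ Subgroup.center _)
    (hc : ∀ i, ∀ m ∈ M, ∀ ξ : A[X], c P N i (π (C m)) (π (X * ξ)) ∈ E)
    {w : SteinbergGroup P N A[X]} (hw : w ∈ rel P N (M.map (C : A →+* A[X]))) :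
    ∃ v, map P N π (w * (map P N C v)⁻¹) ∈ E := by
  have : E.Normal := ⟨fun n hn g => by
    rwa [Subgroup.mem_center_iff.1 (hE hn) g, mul_inv_cancel_right]⟩
  have hcφ (i : ι) (s) (hs : s ∈ (M.map (C : A →+* A[X])).map π) (t)
      (ht : t ∈ (Ideal.span {(X : A[X])}).map π) :
      QuotientGroup.mk' E (c P N i s t) = 1 := by
    obtain ⟨f, hf, rfl⟩ := (Ideal.mem_map_iff_of_surjective π hsurj).1 hs
    obtain ⟨g, hg, rfl⟩ := (Ideal.mem_map_iff_of_surjective π hsurj).1 ht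
    obtain ⟨ξ, rfl⟩ := Ideal.mem_span_singleton'.1 hg
    rw [hcoeff f hf, mul_comm]
    exact (QuotientGroup.eq_one_iff _).2 (hc i _ (Ideal.mem_map_C_iff.1 hf 0) ξ)
  have hIJ (s) (hs : s ∈ (M.map (C : A →+* A[X])).map π) (t)
      (ht : t ∈ (Ideal.span {(X : A[X])}).map π) : s * t = 0 := by
    obtain ⟨f, hf, rfl⟩ := (Ideal.mem_map_iff_of_surjective π hsurj).1 hs
    obtain ⟨g, hg, rfl⟩ := (Ideal.mem_map_iff_of_surjective π hsurj).1 ht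
    exact hmul f hf g hg
  let ψ := (QuotientGroup.mk' E).comp (map P N π)
  let B := (rel P N M).map (ψ.comp (map P N C))
  -- The part of `f` divisible by `X` gives an element centralising `B`; the constant part
  -- normalises `B` because `rel M` is normal in `St(Φ, A)`.
  have hBx (i : ι) (f : A[X]) : ψ (x P N i f) ∈ Subgroup.normalizer (B : Set _) := by
    have hf : x P N i f = x P N i (X * f.divX) * map P N C (x P N i (f.coeff 0)) := by
      rw [map_x, x_mul_x, X_mul_divX_add]
    rw [hf, map_mul]
    refine mul_mem ?_ (Subgroup.le_normalizer_map (H := rel P N M) (ψ.comp (map P N C))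
      ⟨_, ?_, rfl⟩)
    · have hcomm (b) (hb : b ∈ B) : Commute b (ψ (x P N i (X * f.divX))) := by
        obtain ⟨g, hg, rfl⟩ := hb
        exact commute_map_rel_x hIJ hcφ (map_mem_rel P N π Ideal.le_comap_map
          (map_mem_rel P N C Ideal.le_comap_map hg)) i (Ideal.mem_map_of_mem π
            (Ideal.mul_mem_right f.divX _ (Ideal.mem_span_singleton_self X)))
      refine Subgroup.mem_normalizer_iff.2 fun b => ⟨fun hb => ?_, fun hb => ?_⟩
      · rwa [← (hcomm b hb).eq, mul_inv_cancel_right]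
      · have := (hcomm _ hb).eq
        rw [inv_mul_cancel_right, mul_right_inj] at this
        rwa [← this] at hb
    · have := rel_normal P N M
      rw [Subgroup.normalizer_eq_top]
      trivial
  have hBnormal : (B.comap ψ).Normal := by
    have htop : (⊤ : Subgroup (SteinbergGroup P N A[X])) ≤
        (Subgroup.normalizer (B : Set _)).comap ψ := by
      rw [← closure_range_x, Subgroup.closure_le]
      rintro _ ⟨⟨i, f⟩, rfl⟩
      exact hBx i f
    refine ⟨fun n hn g => ?_⟩
    have hg : ψ g ∈ Subgroup.normalizer (B : Set _) := htop (Subgroup.mem_top g)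
    rw [Subgroup.mem_comap, map_mul, map_mul, map_inv]
    exact (Subgroup.mem_normalizer_iff.1 hg _).1 hn
  have hrel : rel P N (M.map (C : A →+* A[X])) ≤ B.comap ψ := by
    refine rel_le P N fun i s hs => ?_
    refine ⟨x P N i (s.coeff 0), x_mem_rel P N i (Ideal.mem_map_C_iff.1 hs 0), ?_⟩
    simp only [ψ, MonoidHom.comp_apply, map_x]
    rw [hcoeff s hs]
  obtain ⟨v, -, hv⟩ := hrel hw
  refine ⟨v, ?_⟩
  rw [← QuotientGroup.eq_one_iff]
  change ψ (w * (map P N C v)⁻¹) = 1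
  rw [map_mul, map_inv, mul_inv_eq_one]
  exact hv.symm

/-- A subset of `evalKer` with central image modulo `X M[X]` generates `evalKer` together with
`rel (X M[X])` as soon as its image generates the images of all `c_i(m, X ξ)`, `m ∈ M`. -/
theorem evalKer_eq_closure (T : Set (SteinbergGroup P N A[X])) (hT : T ⊆ evalKer P N A M)
    (hcentral : Subgroup.closure (reduction P N A M '' T) ≤ Subgroup.center _)
    (hc : ∀ (i : ι) (m : A) (ξ : A[X]), m ∈ M → reduction P N A M (c P N i (C m) (X * ξ)) ∈
      Subgroup.closure (reduction P N A M '' T)) :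
    evalKer P N A M =
      Subgroup.closure
        ((rel P N (Ideal.span {X} * M.map (C : A →+* A[X])) : Set _) ∪ T) := by
  have hge : Subgroup.closure
      ((rel P N (Ideal.span {X} * M.map (C : A →+* A[X])) : Set _) ∪ T) ≤ evalKer P N A M := by
    rw [Subgroup.closure_le]
    exact Set.union_subset (rel_le_evalKer P N) hT
  refine le_antisymm (fun w hw => ?_) hge
  obtain ⟨hwI, hw0⟩ := (mem_evalKer P N).1 hw
  obtain ⟨v, hv⟩ := exists_map_C_of_mem_rel P N Ideal.Quotient.mk_surjective
    (fun s hs => mk_eq_mk_C_coeff_zero hs) (fun s hs t ht => mk_mul_mk_eq_zero hs ht) hcentral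
    (fun i m hm ξ => by rw [← map_c]; exact hc i m ξ hm) hwI
  have hwv : w * (map P N C v)⁻¹ ∈ Subgroup.closure
      ((rel P N (Ideal.span {X} * M.map (C : A →+* A[X])) : Set _) ∪ T) := by
    refine (Subgroup.closure_ker_union (reduction P N A M) T).ge ?_
    exact hv
  -- Evaluation at `0` kills `w` and the proposed generators, and it recovers `v` from its constant
  -- lift.
  have hv1 : v = 1 := by
    have h := ((mem_evalKer P N).1 (hge hwv)).2
    rw [map_mul, map_inv, hw0, one_mul, inv_eq_one, map_map] at h
    have hid : (evalRingHom (0 : A)).comp C = RingHom.id A := by ext; simp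
    have hmap : map P N (RingHom.id A) = MonoidHom.id _ := hom_ext P N fun i a => by simp [map_x]
    rwa [hid, hmap] at h
  rwa [hv1, map_one, inv_one, mul_one] at hwv

theorem closure_reduction_image_le_center {T : Set (SteinbergGroup P N A[X])}
    (hT : ∀ g ∈ T, ∃ i, g ∈ cSet P N A M i) :
    Subgroup.closure (reduction P N A M '' T) ≤ Subgroup.center _ := by
  rw [Subgroup.closure_le]
  rintro _ ⟨g, hg, rfl⟩
  obtain ⟨i, m, ξ, hm, rfl⟩ := hT g hg
  rw [reduction, map_c]
  exact c_mem_center P N i (mk_mul_mk_eq_zero (Ideal.mem_map_of_mem (C : A →+* A[X]) hm)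
    (Ideal.mul_mem_right ξ _ (Ideal.mem_span_singleton_self X)))

end SteinbergGroup

theorem mainTheorem8
    {ι K V W L A : Type*} [Finite ι] [Field K] [CharZero K]
    [AddCommGroup V] [Module K V] [AddCommGroup W] [Module K W]
    -- an irreducible reduced crystallographic root system of rank at least two,
    (P : RootPairing ι K V W) [P.IsRootSystem] [P.IsCrystallographic] [P.IsReduced]
    [P.IsIrreducible] (hrank : 2 ≤ Module.finrank K V)
    -- whose Dynkin diagram is simply laced
    (b : P.Base) (hb : b.cartanMatrix.IsSimplyLaced)
    -- a choice of structure constants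
    [LieRing L] [LieAlgebra K L] (B : ChevalleyBasis P L)
    [CommRing A] [IsLocalRing A] :
    SteinbergGroup.evalKer P B.N A (maximalIdeal A) =
      Subgroup.closure
        ((SteinbergGroup.rel P B.N
            (Ideal.span {X} * (maximalIdeal A).map (C : A →+* A[X])) : Set _) ∪
          {g | ∃ (i : ι) (m : A) (ξ : A[X]), m ∈ maximalIdeal A ∧
            g = SteinbergGroup.c P B.N i (C m) (X * ξ)}) ∧
    ∀ γ : ι, SteinbergGroup.evalKer P B.N A (maximalIdeal A) =
      Subgroup.closure
        ((SteinbergGroup.rel P B.N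
            (Ideal.span {X} * (maximalIdeal A).map (C : A →+* A[X])) : Set _) ∪
          {g | ∃ (m : A) (η : A[X]), m ∈ maximalIdeal A ∧
            g = SteinbergGroup.c P B.N γ (C m) (X * η)}) := by
  have : P.IsPairingSymm := ⟨RootPairing.pairingIn_comm_of_isSimplyLaced b hb⟩
  have : SteinbergGroup.IsSimplyLacedDatum P B.N :=
    ⟨RootPairing.exists_add_eq hrank, fun _ _ _ h => B.isUnit_N h⟩
  refine ⟨SteinbergGroup.evalKer_eq_closure P B.N _ ?_ ?_ ?_, fun γ =>
    SteinbergGroup.evalKer_eq_closure P B.N _ ?_ ?_ ?_⟩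
  · rintro _ ⟨i, m, ξ, hm, rfl⟩
    exact SteinbergGroup.c_mem_evalKer P B.N i hm ξ
  · exact SteinbergGroup.closure_reduction_image_le_center P B.N fun _ hg => hg
  · exact fun i m ξ hm => Subgroup.subset_closure ⟨_, ⟨i, m, ξ, hm, rfl⟩, rfl⟩
  · rintro _ ⟨m, ξ, hm, rfl⟩
    exact SteinbergGroup.c_mem_evalKer P B.N γ hm ξ
  · exact SteinbergGroup.closure_reduction_image_le_center P B.N fun _ hg => ⟨γ, hg⟩
  · exact fun i m ξ hm => SteinbergGroup.reduction_c_mem_closure_cSet P B.N hrank γ i hm ξ
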